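/- Write $\mathbb{Z}+\tfrac12=\{k+\tfrac12:k\in\mathbb{Z}\}$. For $x,y\in\mathbb{Z}+\tfrac12$ and $\xi>0$ let the discrete Bessel kernel be $$K_{\mathrm{Bessel}}(x,y;\xi)=\frac{1}{(2\pi i)^2}\oint_{|z|=R}\oint_{|w|=r}\frac{e^{\sqrt{\xi}\,(z-z^{-1}-w+w^{-1})}}{z-w}\,\frac{dw\,dz}{z^{x+\frac12}\,w^{-y+\frac12}},$$ where the circles are centred at $0$ and traversed counterclockwise, and the radii $R>r>0$ may be chosen arbitrarily (also differently for different $x,y,\xi$). For $k\in\mathbb{Z}$ and $\phi\in\mathbb{R}$ let the discrete sine kernel be $$K_{\sin}(k;\phi)=\frac{\sin(\phi k)}{\pi k}\quad(k\neq0),\qquad K_{\sin}(0;\phi)=\frac{\phi}{\pi}.$$ Let $u\in(-2,2)$, let $\xi\to\infty$, and let $x,y\in\mathbb{Z}+\tfrac12$ vary with $\xi$ in such a way that $$\frac{x}{\sqrt\xi}\to u,\qquad \frac{y}{\sqrt\xi}\to u,$$ while the difference $x-y$ remains fixed. Then $$K_{\mathrm{Bessel}}(x,y;\xi)\to K_{\sin}(x-y;\phi),\qquad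 \phi=\arccos(u/2).$$ The limit may be taken along an arbitrary filter on an index set, in particular along any sequence. -/

import Mathlib

open Filter Topology

noncomputable section

/-- The shifted lattice `ℤ + 1/2`, as a set of real numbers. -/
def halfIntegers : Set ℝ := {x | ∃ k : ℤ, x = (k : ℝ) + 1 / 2}

/-- The discrete Bessel kernel
`(2πi)⁻² ∮_{|z| = R} ∮_{|w| = r} exp(√ξ (z - z⁻¹ - w + w⁻¹)) / (z - w) · dw dz / (z^(x+1/2) w^(-y+1/2))`,
for half-integers `x`, `y` (so that the two exponents are integers, and the complex powers are
ordinary integral powers) and radii `R > r > 0`.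
Both circles are traversed counterclockwise. -/
def besselKernel (R r x y ξ : ℝ) : ℂ :=
  (1 / (2 * (Real.pi : ℂ) * Complex.I) ^ 2) *
    ∮ z in C(0, R), ∮ w in C(0, r),
      Complex.exp ((Real.sqrt ξ : ℂ) * (z - z⁻¹ - w + w⁻¹)) / (z - w) *
        (1 / (z ^ ((x : ℂ) + 1 / 2) * w ^ (-(y : ℂ) + 1 / 2)))

/-- The discrete sine kernel `sin (φ k) / (π k)`, `k ∈ ℤ`, with the value `φ / π` at `k = 0`. -/
def sineKernel (k : ℤ) (φ : ℝ) : ℝ :=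
  if k = 0 then φ / Real.pi else Real.sin (φ * k) / (Real.pi * k)

end

open scoped ComplexConjugate
open MeasureTheory

/-! Put t = √ξ. Expanding 1/(z - w) geometrically and using Schläfli's integral turns the kernel
into the half-line sum ∑_{j≥0} J_{m+1+j}(2t) J_{n+1+j}(2t), with x = m + 1/2, y = n + 1/2
(`hasSum_besselJ_mul_besselJ`). No asymptotics of individual Bessel functions are needed: the sum is
read as the mass of a half-line under a spectral measure.

By polarization it suffices to treat the squares (J_{n+d+j} + J_{n+j})². Over all j ∈ ℤ they have a
finite total independent of t and n, so after normalization they are probability weights, placed at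
the points j/t. Parseval for a function and its translate by s/t computes their characteristic
function (`hasSum_besselJ_sq_mul_exp`). As t → ∞ the phase 2t(sin(θ + s/t) - sin θ) - ns/t tends to
s(2 cos θ - u), so the limit is the characteristic function of 2 cos θ - u, with θ distributed on
(-π, π] with density proportional to 2 + 2 cos(dθ).

This law has no atom at 0, so Lévy's theorem gives convergence of the mass of [0, ∞)
(`tendsto_tsum_nat_of_tendsto_charFun`). The condition 2 cos θ ≥ u means |θ| ≤ arccos(u/2), and
integrating cos(dθ) over that arc gives the sine kernel. -/

/-! ### Fourier coefficients and Parseval's identity -/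

/-- The `j`-th Fourier coefficient of a `2π`-periodic function on the line. -/
noncomputable def periodicCoeff (f : ℝ → ℂ) (j : ℤ) : ℂ :=
  (1 / (2 * (Real.pi : ℂ))) *
    ∫ θ in (-Real.pi)..Real.pi, Complex.exp (-(j * θ * Complex.I)) * f θ

theorem integral_haarAddCircle_two_pi [Fact (0 < 2 * Real.pi)] (F : AddCircle (2 * Real.pi) → ℂ) :
    ∫ x, F x ∂AddCircle.haarAddCircle =
      (1 / (2 * (Real.pi : ℂ))) * ∫ θ in (-Real.pi)..Real.pi, F (θ : AddCircle (2 * Real.pi)) := by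
  rw [AddCircle.integral_haarAddCircle, ← AddCircle.intervalIntegral_preimage _ (-Real.pi),
    show -Real.pi + 2 * Real.pi = Real.pi by ring, Complex.real_smul]
  simp

theorem fourierCoeff_lift_eq_periodicCoeff [Fact (0 < 2 * Real.pi)] {f : ℝ → ℂ}
    (hp : Function.Periodic f (2 * Real.pi)) (j : ℤ) :
    fourierCoeff (T := 2 * Real.pi) hp.lift j = periodicCoeff f j := by
  rw [fourierCoeff, integral_haarAddCircle_two_pi, periodicCoeff]
  congr 1
  refine intervalIntegral.integral_congr fun θ _ => ?_
  simp only [smul_eq_mul]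
  rw [fourier_coe_apply]
  congr 2
  have : (Real.pi : ℂ) ≠ 0 := by exact_mod_cast Real.pi_ne_zero
  push_cast
  field_simp

/-- Parseval's identity for continuous `2π`-periodic functions on the line. -/
theorem hasSum_conj_periodicCoeff_mul {f g : ℝ → ℂ} (hf : Continuous f) (hg : Continuous g)
    (hfp : Function.Periodic f (2 * Real.pi)) (hgp : Function.Periodic g (2 * Real.pi)) :
    HasSum (fun j : ℤ => conj (periodicCoeff f j) * periodicCoeff g j)
      ((1 / (2 * (Real.pi : ℂ))) * ∫ θ in (-Real.pi)..Real.pi, conj (f θ) * g θ) := by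
  have : Fact (0 < 2 * Real.pi) := ⟨Real.two_pi_pos⟩
  let F : C(AddCircle (2 * Real.pi), ℂ) := ⟨hfp.lift, continuous_coinduced_dom.mpr hf⟩
  let G : C(AddCircle (2 * Real.pi), ℂ) := ⟨hgp.lift, continuous_coinduced_dom.mpr hg⟩
  have key := fourierBasis.hasSum_inner_mul_inner
    (ContinuousMap.toLp (E := ℂ) 2 AddCircle.haarAddCircle ℂ F)
    (ContinuousMap.toLp (E := ℂ) 2 AddCircle.haarAddCircle ℂ G)
  rw [MeasureTheory.ContinuousMap.inner_toLp, integral_haarAddCircle_two_pi] at key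
  have e : ∫ θ in (-Real.pi)..Real.pi, conj (f θ) * g θ =
      ∫ θ in (-Real.pi)..Real.pi, G (θ : AddCircle (2 * Real.pi)) *
        conj (F (θ : AddCircle (2 * Real.pi))) :=
    intervalIntegral.integral_congr fun θ _ => mul_comm _ _
  rw [e]
  refine (congrArg (HasSum · _) (funext fun j => ?_)).mp key
  symm
  rw [← inner_conj_symm, ← HilbertBasis.repr_apply_apply, ← HilbertBasis.repr_apply_apply,
    fourierBasis_repr, fourierBasis_repr, fourierCoeff_toLp, fourierCoeff_toLp,
    ← fourierCoeff_lift_eq_periodicCoeff hfp, ← fourierCoeff_lift_eq_periodicCoeff hgp]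
  rfl

theorem exp_int_mul_periodic (j : ℤ) :
    Function.Periodic (fun θ : ℝ => Complex.exp (-(j * θ * Complex.I))) (2 * Real.pi) := by
  intro θ
  have : -((j : ℂ) * ((θ + 2 * Real.pi : ℝ) : ℂ) * Complex.I) =
      -(j * θ * Complex.I) + ((-j : ℤ) : ℂ) * (2 * Real.pi * Complex.I) := by
    push_cast; ring
  simp only [this]
  rw [Complex.exp_add, Complex.exp_int_mul_two_pi_mul_I, mul_one]

theorem periodicCoeff_shift {f : ℝ → ℂ} (hp : Function.Periodic f (2 * Real.pi)) (α : ℝ) (j : ℤ) :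
    periodicCoeff (fun θ => f (θ + α)) j = Complex.exp (j * α * Complex.I) * periodicCoeff f j := by
  have h1 : ∀ θ : ℝ, Complex.exp (-(j * θ * Complex.I)) * f (θ + α) =
      Complex.exp (j * α * Complex.I) *
        (fun θ : ℝ => Complex.exp (-(j * θ * Complex.I)) * f θ) (θ + α) := by
    intro θ
    simp only
    rw [← mul_assoc, ← Complex.exp_add]
    congr 2
    push_cast; ring
  have h2 : Function.Periodic (fun θ : ℝ => Complex.exp (-(j * θ * Complex.I)) * f θ)
      (2 * Real.pi) := (exp_int_mul_periodic j).mul hp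
  rw [periodicCoeff, periodicCoeff]
  simp_rw [h1]
  rw [intervalIntegral.integral_const_mul, intervalIntegral.integral_comp_add_right
      (fun θ : ℝ => Complex.exp (-(j * θ * Complex.I)) * f θ)]
  have h3 := h2.intervalIntegral_add_eq (-Real.pi + α) (-Real.pi)
  rw [show -Real.pi + α + 2 * Real.pi = Real.pi + α by ring,
    show -Real.pi + 2 * Real.pi = Real.pi by ring] at h3
  rw [h3]
  ring

theorem periodicCoeff_exp_mul (f : ℝ → ℂ) (m j : ℤ) :
    periodicCoeff (fun θ => Complex.exp (-(m * θ * Complex.I)) * f θ) j =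
      periodicCoeff f (m + j) := by
  rw [periodicCoeff, periodicCoeff]
  congr 1
  refine intervalIntegral.integral_congr fun θ _ => ?_
  simp only [← mul_assoc, ← Complex.exp_add]
  congr 2
  push_cast; ring

theorem periodicCoeff_add {f g : ℝ → ℂ} (hf : Continuous f) (hg : Continuous g) (j : ℤ) :
    periodicCoeff (fun θ => f θ + g θ) j = periodicCoeff f j + periodicCoeff g j := by
  simp only [periodicCoeff, mul_add]
  rw [intervalIntegral.integral_add, mul_add]
  · exact Continuous.intervalIntegrable (by fun_prop) _ _
  · exact Continuous.intervalIntegrable (by fun_prop) _ _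

/-! ### Bessel functions as Fourier coefficients -/

/-- The generating function `exp (2 i t sin θ)` of the Bessel functions `Jₙ(2t)`. -/
noncomputable def besselGen (t θ : ℝ) : ℂ := Complex.exp ((2 * t * Real.sin θ : ℝ) * Complex.I)

theorem continuous_besselGen (t : ℝ) : Continuous (besselGen t) := by
  unfold besselGen; fun_prop

theorem besselGen_periodic (t : ℝ) : Function.Periodic (besselGen t) (2 * Real.pi) := by
  intro θ; simp [besselGen]

theorem conj_exp_ofReal_mul_I (a : ℝ) :
    conj (Complex.exp (a * Complex.I)) = Complex.exp (-(a * Complex.I)) := by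
  rw [← Complex.exp_conj]; simp

theorem conj_besselGen (t θ : ℝ) : conj (besselGen t θ) = besselGen t (-θ) := by
  rw [besselGen, conj_exp_ofReal_mul_I, besselGen, Real.sin_neg]
  congr 1; push_cast; ring

/-- The coefficients are real because conjugating the generating function amounts to θ ↦ -θ. -/
theorem conj_periodicCoeff_besselGen (t : ℝ) (n : ℤ) :
    conj (periodicCoeff (besselGen t) n) = periodicCoeff (besselGen t) n := by
  rw [periodicCoeff, map_mul, ← intervalIntegral.intervalIntegral_conj]
  have h : ∀ θ : ℝ, conj (Complex.exp (-(n * θ * Complex.I)) * besselGen t θ) =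
      (fun θ : ℝ => Complex.exp (-(n * θ * Complex.I)) * besselGen t θ) (-θ) := by
    intro θ
    simp only
    rw [map_mul, conj_besselGen, ← Complex.exp_conj]
    simp
  simp_rw [h]
  rw [intervalIntegral.integral_comp_neg
    (fun θ : ℝ => Complex.exp (-(n * θ * Complex.I)) * besselGen t θ)]
  simp [Complex.conj_ofNat]

/-- The Bessel function of the first kind `Jₙ(2t)` of integer order. -/
noncomputable def besselJ (t : ℝ) (n : ℤ) : ℝ := (periodicCoeff (besselGen t) n).re

theorem ofReal_besselJ (t : ℝ) (n : ℤ) : (besselJ t n : ℂ) = periodicCoeff (besselGen t) n :=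
  Complex.conj_eq_iff_re.mp (conj_periodicCoeff_besselGen t n)

/-- Parseval for h and its translate h(· + α), where h has coefficients J_{n+d+j} + J_{n+j}:
translation multiplies the j-th coefficient by e^{ijα}, so the pairing is the unnormalized
characteristic function of the squared coefficients. -/
theorem hasSum_besselJ_sq_mul_exp (t α : ℝ) (n d : ℤ) :
    HasSum (fun j : ℤ => (((besselJ t (n + d + j) + besselJ t (n + j)) ^ 2 : ℝ) : ℂ) *
        Complex.exp (j * α * Complex.I))
      ((1 / (2 * (Real.pi : ℂ))) * ∫ θ in (-Real.pi)..Real.pi,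
        Complex.exp ((2 * t * (Real.sin (θ + α) - Real.sin θ) - n * α : ℝ) * Complex.I) *
          ((Complex.exp ((d * θ : ℝ) * Complex.I) + 1) *
            (Complex.exp ((-(d * (θ + α)) : ℝ) * Complex.I) + 1))) := by
  set e : ℤ → ℝ → ℂ := fun m θ => Complex.exp (-(m * θ * Complex.I)) * besselGen t θ with he
  have hec (m : ℤ) : Continuous (e m) := by
    have := continuous_besselGen t
    simp only [he]; fun_prop
  have hep (m : ℤ) : Function.Periodic (e m) (2 * Real.pi) :=
    (exp_int_mul_periodic m).mul (besselGen_periodic t)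
  set h : ℝ → ℂ := fun θ => e (n + d) θ + e n θ with hh
  have hhc : Continuous h := (hec _).add (hec _)
  have hhp : Function.Periodic h (2 * Real.pi) := (hep _).add (hep _)
  have hcoef (j : ℤ) : periodicCoeff h j =
      ((besselJ t (n + d + j) + besselJ t (n + j) : ℝ) : ℂ) := by
    rw [hh, periodicCoeff_add (hec _) (hec _), he]
    simp only [periodicCoeff_exp_mul, ← ofReal_besselJ]
    push_cast; rfl
  have hsp : Function.Periodic (fun θ => h (θ + α)) (2 * Real.pi) := fun θ => by
    have := hhp (θ + α)
    simp only
    rw [← this]; congr 1; ring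
  have key := hasSum_conj_periodicCoeff_mul (g := fun θ => h (θ + α)) hhc (by fun_prop) hhp hsp
  have hint : ∫ θ in (-Real.pi)..Real.pi, conj (h θ) * h (θ + α) =
      ∫ θ in (-Real.pi)..Real.pi,
        Complex.exp ((2 * t * (Real.sin (θ + α) - Real.sin θ) - n * α : ℝ) * Complex.I) *
          ((Complex.exp ((d * θ : ℝ) * Complex.I) + 1) *
            (Complex.exp ((-(d * (θ + α)) : ℝ) * Complex.I) + 1)) := by
    refine intervalIntegral.integral_congr fun θ _ => ?_
    have e1 : h (θ + α) = Complex.exp ((2 * t * Real.sin (θ + α) - n * (θ + α) : ℝ) * Complex.I) *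
        (Complex.exp ((-(d * (θ + α)) : ℝ) * Complex.I) + 1) := by
      simp only [hh, he, besselGen, mul_add, ← Complex.exp_add, mul_one]
      congr 2 <;> push_cast <;> ring
    have e2 : conj (h θ) = Complex.exp ((n * θ - 2 * t * Real.sin θ : ℝ) * Complex.I) *
        (Complex.exp ((d * θ : ℝ) * Complex.I) + 1) := by
      simp only [hh, he, map_add, map_mul, conj_besselGen]
      simp only [besselGen, ← Complex.exp_conj, mul_add, ← Complex.exp_add, mul_one]
      congr 2 <;> simp <;> ring
    rw [e1, e2, mul_mul_mul_comm, ← Complex.exp_add]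
    congr 2
    push_cast; ring
  rw [hint] at key
  refine (congrArg (HasSum · _) (funext fun j => ?_)).mp key
  symm
  rw [periodicCoeff_shift hhp, hcoef, Complex.conj_ofReal]
  push_cast; ring

/-- This is |e^{idθ} + 1|². The form `θ + 0` matches α = 0 in the preceding Parseval formula. -/
theorem exp_add_one_mul_exp_neg_add_one (d : ℤ) (θ : ℝ) :
    (Complex.exp ((d * θ : ℝ) * Complex.I) + 1) *
      (Complex.exp ((-(d * (θ + 0)) : ℝ) * Complex.I) + 1) =
      ((2 + 2 * Real.cos (d * θ) : ℝ) : ℂ) := by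
  have e1 : Complex.exp ((d * θ : ℝ) * Complex.I) *
      Complex.exp ((-(d * (θ + 0)) : ℝ) * Complex.I) = 1 := by
    rw [← Complex.exp_add, ← Complex.exp_zero]
    congr 1; push_cast; ring
  have e2 : ((2 * Real.cos (d * θ) : ℝ) : ℂ) = Complex.exp ((d * θ : ℝ) * Complex.I) +
      Complex.exp ((-(d * (θ + 0)) : ℝ) * Complex.I) := by
    push_cast
    rw [Complex.two_cos]
    congr 2
    ring
  rw [Complex.ofReal_add, e2]
  push_cast at e1 ⊢
  linear_combination e1

/-! ### Convergence of characteristic functions and of half-line masses -/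

theorem tendsto_mul_sin_add_div_sub_sin (s θ : ℝ) :
    Tendsto (fun t : ℝ => t * (Real.sin (θ + s / t) - Real.sin θ)) atTop
      (𝓝 (s * Real.cos θ)) := by
  have h1 : HasDerivAt (fun τ : ℝ => Real.sin (θ + s * τ)) (s * Real.cos θ) 0 := by
    have h2 : HasDerivAt (fun τ : ℝ => θ + s * τ) s 0 := by
      simpa using ((hasDerivAt_id (0 : ℝ)).const_mul s).const_add θ
    have h3 := (Real.hasDerivAt_sin (θ + s * 0)).comp (0 : ℝ) h2
    simpa [mul_comm, Function.comp_def] using h3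
  refine (h1.tendsto_slope_zero_right.comp tendsto_inv_atTop_nhdsGT_zero).congr fun t => ?_
  simp [div_eq_mul_inv]

/-- The characteristic functions of the rescaled spectral weights converge. -/
theorem tendsto_tsum_besselJ_sq_mul_exp {ι : Type*} {l : Filter ι} [l.IsCountablyGenerated]
    {t : ι → ℝ} {n : ι → ℤ} {u : ℝ} (ht : Tendsto t l atTop)
    (hn : Tendsto (fun i => n i / t i) l (𝓝 u)) (d : ℤ) (s : ℝ) :
    Tendsto (fun i => ∑' j : ℤ,
        (((besselJ (t i) (n i + d + j) + besselJ (t i) (n i + j)) ^ 2 : ℝ) : ℂ) *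
        Complex.exp (j * (s / t i : ℝ) * Complex.I)) l
      (𝓝 ((1 / (2 * (Real.pi : ℂ))) * ∫ θ in (-Real.pi)..Real.pi,
        Complex.exp ((s * (2 * Real.cos θ - u) : ℝ) * Complex.I) *
          ((2 + 2 * Real.cos (d * θ) : ℝ) : ℂ))) := by
  simp only [fun i => (hasSum_besselJ_sq_mul_exp (t i) (s / t i) (n i) d).tsum_eq]
  refine Tendsto.const_mul _ ?_
  refine intervalIntegral.tendsto_integral_filter_of_dominated_convergence (fun _ => 4) ?_ ?_ ?_ ?_
  · refine Eventually.of_forall fun i => Continuous.aestronglyMeasurable ?_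
    fun_prop
  · refine Eventually.of_forall fun i => Eventually.of_forall fun θ _ => ?_
    rw [norm_mul, norm_mul, Complex.norm_exp_ofReal_mul_I, one_mul]
    have hb (a : ℝ) : ‖Complex.exp (a * Complex.I) + 1‖ ≤ 2 := by
      refine (norm_add_le _ _).trans ?_
      rw [Complex.norm_exp_ofReal_mul_I]; norm_num
    calc _ ≤ (2 : ℝ) * 2 := mul_le_mul (hb _) (hb _) (norm_nonneg _) (by norm_num)
      _ = 4 := by norm_num
  · exact intervalIntegrable_const
  · refine Eventually.of_forall fun θ _ => ?_
    rw [← exp_add_one_mul_exp_neg_add_one]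
    have hs : Tendsto (fun i => s / t i) l (𝓝 0) := tendsto_const_nhds.div_atTop ht
    refine Tendsto.mul ?_ (Tendsto.mul tendsto_const_nhds ?_)
    · have h1 : Tendsto (fun i => 2 * t i * (Real.sin (θ + s / t i) - Real.sin θ) - n i * (s / t i))
          l (𝓝 (s * (2 * Real.cos θ - u))) := by
        have h2 := (((tendsto_mul_sin_add_div_sub_sin s θ).comp ht).const_mul 2).sub
          (hn.const_mul s)
        convert h2 using 2
        · simp only [Function.comp]; ring
        · ring
      exact ((Complex.continuous_exp.comp
        (Complex.continuous_ofReal.mul continuous_const)).tendsto _).comp h1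
    · exact (((by fun_prop : Continuous fun α : ℝ =>
        Complex.exp ((-(d * (θ + α)) : ℝ) * Complex.I) + 1).tendsto 0).comp hs)

/-- If the characteristic functions of probability weights `a k j` at the points `j / t k`
converge to that of a measure without an atom at `0`, then the mass of `[0, ∞)` converges. -/
theorem tendsto_tsum_nat_of_tendsto_charFun {a : ℕ → ℤ → ℝ} (ha : ∀ k j, 0 ≤ a k j)
    (hsum : ∀ k, HasSum (a k) 1) {t : ℕ → ℝ} (ht : ∀ᶠ k in atTop, 0 < t k)
    {ν : Measure ℝ} [IsProbabilityMeasure ν] (h0 : ν {0} = 0)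
    (hchar : ∀ s : ℝ, Tendsto (fun k => ∑' j : ℤ, (a k j : ℂ) *
      Complex.exp (j * (s / t k : ℝ) * Complex.I)) atTop (𝓝 (charFun ν s))) :
    Tendsto (fun k => ∑' j : ℕ, a k j) atTop (𝓝 (ν.real (Set.Ici 0))) := by
  have hp (k : ℕ) : HasSum (fun j => ENNReal.ofReal (a k j)) 1 := by
    rw [← ENNReal.ofReal_one, ← (hsum k).tsum_eq,
      ENNReal.ofReal_tsum_of_nonneg (ha k) (hsum k).summable]
    exact ENNReal.summable.hasSum
  let p : ℕ → PMF ℤ := fun k => ⟨fun j => ENNReal.ofReal (a k j), hp k⟩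
  have hpa (k : ℕ) (j : ℤ) : p k j = ENNReal.ofReal (a k j) := rfl
  have hmeas (k : ℕ) : Measurable fun j : ℤ => (j : ℝ) / t k := Measurable.of_discrete
  let μ : ℕ → ProbabilityMeasure ℝ := fun k =>
    ⟨(p k).toMeasure.map fun j : ℤ => (j : ℝ) / t k,
      Measure.isProbabilityMeasure_map (hmeas k).aemeasurable⟩
  have hμ (k : ℕ) : (μ k : Measure ℝ) = (p k).toMeasure.map fun j : ℤ => (j : ℝ) / t k := rfl
  let ν' : ProbabilityMeasure ℝ := ⟨ν, inferInstance⟩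
  have hconv : Tendsto μ atTop (𝓝 ν') := by
    refine ProbabilityMeasure.tendsto_of_tendsto_charFun fun s => ?_
    refine (hchar s).congr fun k => ?_
    rw [charFun_apply_real, hμ, integral_map (hmeas k).aemeasurable (by fun_prop),
      PMF.integral_eq_tsum]
    · refine tsum_congr fun j => ?_
      rw [hpa, ENNReal.toReal_ofReal (ha k j), Complex.real_smul]
      congr 2
      push_cast; ring
    · refine Integrable.of_bound (C := 1) (by fun_prop) (Eventually.of_forall fun j => ?_)
      rw [← Complex.ofReal_mul, Complex.norm_exp_ofReal_mul_I]
  -- Portmanteau: the frontier of [0, ∞) is {0}, which is null for the limit.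
  have h1 := ProbabilityMeasure.tendsto_measure_of_null_frontier_of_tendsto' hconv
    (E := Set.Ici 0) (by rw [frontier_Ici]; exact h0)
  have h2 := (ENNReal.tendsto_toReal (measure_ne_top ν (Set.Ici 0))).comp h1
  refine h2.congr' ?_
  filter_upwards [ht] with k hk
  have hset : (fun j : ℤ => (j : ℝ) / t k) ⁻¹' Set.Ici 0 = Set.range ((↑) : ℕ → ℤ) := by
    ext j
    simp only [Set.mem_preimage, Set.mem_Ici, Set.mem_range]
    constructor
    · intro h
      have h3 : (0 : ℝ) ≤ j := by
        rcases div_nonneg_iff.mp h with h | h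
        · exact h.1
        · linarith [h.2]
      exact ⟨j.toNat, Int.toNat_of_nonneg (by exact_mod_cast h3)⟩
    · rintro ⟨m, rfl⟩
      positivity
  rw [Function.comp_apply, hμ, Measure.map_apply (hmeas k) measurableSet_Ici, hset,
    PMF.toMeasure_apply_eq_tsum, ← tsum_subtype, tsum_range _ Nat.cast_injective]
  simp only [hpa]
  rw [← ENNReal.ofReal_tsum_of_nonneg (f := fun j : ℕ => a k j) (fun j => ha k j)
    ((hsum k).summable.comp_injective (i := ((↑) : ℕ → ℤ)) Nat.cast_injective), ENNReal.toReal_ofReal]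
  exact tsum_nonneg fun j => ha k j

/-! ### The limit law and the sine kernel -/

theorem integral_cos_eq_sineKernel (d : ℤ) (φ : ℝ) :
    1 / (2 * Real.pi) * ∫ θ in (-φ)..φ, Real.cos (d * θ) = sineKernel d φ := by
  have hpi := Real.pi_ne_zero
  by_cases hd : d = 0
  · subst hd
    simp [sineKernel]
    field_simp
    ring
  · have hd' : (d : ℝ) ≠ 0 := by exact_mod_cast hd
    rw [sineKernel, if_neg hd, intervalIntegral.integral_comp_mul_left _ hd',
      integral_cos, mul_neg, Real.sin_neg, mul_comm φ, smul_eq_mul]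
    field_simp
    ring

theorem hasSum_besselJ_sq (t : ℝ) (n d : ℤ) :
    HasSum (fun j : ℤ => (besselJ t (n + d + j) + besselJ t (n + j)) ^ 2)
      (1 / (2 * Real.pi) * ∫ θ in (-Real.pi)..Real.pi, (2 + 2 * Real.cos (d * θ))) := by
  have key := hasSum_besselJ_sq_mul_exp t 0 n d
  simp only [exp_add_one_mul_exp_neg_add_one] at key
  simp only [add_zero, sub_self, mul_zero, Complex.ofReal_zero, zero_mul, Complex.exp_zero,
    one_mul, mul_one, intervalIntegral.integral_ofReal] at key
  rw [← Complex.hasSum_ofReal]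
  convert key using 1
  push_cast; rfl

theorem integral_two_add_two_mul_cos (d : ℤ) (φ : ℝ) :
    1 / (2 * Real.pi) * ∫ θ in (-φ)..φ, (2 + 2 * Real.cos (d * θ)) =
      2 * sineKernel 0 φ + 2 * sineKernel d φ := by
  rw [intervalIntegral.integral_add intervalIntegrable_const
    (Continuous.intervalIntegrable (by fun_prop) _ _), intervalIntegral.integral_const_mul,
    ← integral_cos_eq_sineKernel d]
  have hpi := Real.pi_ne_zero
  simp [sineKernel]
  field_simp
  ring

/-- This is the total mass of the squared weights: 4 if d = 0 and 2 otherwise, since sin(πd) = 0.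
Positivity allows normalization. -/
theorem two_add_two_mul_sineKernel_pi_pos (d : ℤ) :
    0 < 2 * sineKernel 0 Real.pi + 2 * sineKernel d Real.pi := by
  have h0 : sineKernel 0 Real.pi = 1 := by simp [sineKernel, Real.pi_ne_zero]
  by_cases hd : d = 0
  · subst hd; rw [h0]; norm_num
  · rw [h0, sineKernel, if_neg hd, mul_comm Real.pi, Real.sin_int_mul_pi]; norm_num

/-- Cosine is even and decreasing on [0, π]; u > -2 keeps the arc strictly inside (-π, π). -/
theorem preimage_Ici_zero_two_mul_cos_sub {u : ℝ} (hu : u ∈ Set.Ioo (-2 : ℝ) 2) :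
    ((fun θ => 2 * Real.cos θ - u) ⁻¹' Set.Ici 0) ∩ Set.Ioc (-Real.pi) Real.pi =
      Set.Icc (-Real.arccos (u / 2)) (Real.arccos (u / 2)) := by
  have hφ0 := Real.arccos_nonneg (u / 2)
  have hφ : Real.arccos (u / 2) < Real.pi :=
    lt_of_le_of_ne (Real.arccos_le_pi _) fun h => by
      rw [Real.arccos_eq_pi] at h; linarith [hu.1]
  have hcos : Real.cos (Real.arccos (u / 2)) = u / 2 :=
    Real.cos_arccos (by linarith [hu.1]) (by linarith [hu.2])
  ext θ
  simp only [Set.mem_inter_iff, Set.mem_preimage, Set.mem_Ici, Set.mem_Ioc, Set.mem_Icc]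
  rw [← abs_le]
  constructor
  · rintro ⟨h1, h2, h3⟩
    have h4 : |θ| ≤ Real.pi := abs_le.mpr ⟨h2.le, h3⟩
    rw [← Real.arccos_cos (abs_nonneg θ) h4, Real.cos_abs]
    exact Real.arccos_le_arccos (by linarith)
  · intro h
    have h1 := Real.cos_le_cos_of_nonneg_of_le_pi (abs_nonneg θ) hφ.le h
    rw [hcos, Real.cos_abs] at h1
    have h2 := abs_lt.mp (h.trans_lt hφ)
    exact ⟨by linarith, h2.1, h2.2.le⟩

/-- The solutions of cos θ = u/2 form two arithmetic progressions, a countable set; hence the limit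
law has no atom at 0. -/
theorem volume_preimage_zero_two_mul_cos_sub {u : ℝ} (hu : u ∈ Set.Ioo (-2 : ℝ) 2) :
    volume ((fun θ => 2 * Real.cos θ - u) ⁻¹' {0}) = 0 := by
  have hcos : Real.cos (Real.arccos (u / 2)) = u / 2 :=
    Real.cos_arccos (by linarith [hu.1]) (by linarith [hu.2])
  refine Set.Countable.measure_zero (Set.Countable.mono ?_
    ((Set.countable_range fun k : ℤ => 2 * k * Real.pi + Real.arccos (u / 2)).union
      (Set.countable_range fun k : ℤ => 2 * k * Real.pi - Real.arccos (u / 2)))) _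
  intro θ hθ
  have h1 : Real.cos (Real.arccos (u / 2)) = Real.cos θ := by
    simp only [Set.mem_preimage, Set.mem_singleton_iff] at hθ
    linarith
  obtain ⟨k, hk | hk⟩ := Real.cos_eq_cos_iff.mp h1
  · exact Or.inl ⟨k, hk.symm⟩
  · exact Or.inr ⟨k, hk.symm⟩

/-! ### Limits of half-line sums and polarization -/

theorem tendsto_tsum_besselJ_sq {t : ℕ → ℝ} {n : ℕ → ℤ} {u : ℝ} (hu : u ∈ Set.Ioo (-2 : ℝ) 2)
    (ht : Tendsto t atTop atTop) (hn : Tendsto (fun k => n k / t k) atTop (𝓝 u)) (d : ℤ) :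
    Tendsto (fun k => ∑' j : ℕ, (besselJ (t k) (n k + d + j) + besselJ (t k) (n k + j)) ^ 2) atTop
      (𝓝 (2 * sineKernel 0 (Real.arccos (u / 2)) + 2 * sineKernel d (Real.arccos (u / 2)))) := by
  set M : ℝ := 2 * sineKernel 0 Real.pi + 2 * sineKernel d Real.pi with hM
  have hM0 : 0 < M := two_add_two_mul_sineKernel_pi_pos d
  have hpi := Real.pi_pos
  set D : ℝ → ℝ := fun θ => 1 / M * (1 / (2 * Real.pi) * (2 + 2 * Real.cos (d * θ))) with hD
  have hD0 (θ : ℝ) : 0 ≤ D θ := by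
    have := Real.neg_one_le_cos (d * θ)
    have : 0 ≤ 2 + 2 * Real.cos (d * θ) := by linarith
    simp only [hD]; positivity
  have hDc : Continuous D := by simp only [hD]; fun_prop
  set ρ : Measure ℝ := (volume.restrict (Set.Ioc (-Real.pi) Real.pi)).withDensity
    fun θ => ENNReal.ofReal (D θ) with hρ
  have hρA {A : Set ℝ} (hA : MeasurableSet A) :
      ρ A = ENNReal.ofReal (∫ θ in A ∩ Set.Ioc (-Real.pi) Real.pi, D θ) := by
    rw [hρ, withDensity_apply _ hA, Measure.restrict_restrict hA,
      ofReal_integral_eq_lintegral_ofReal _ (Eventually.of_forall hD0)]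
    exact (hDc.integrableOn_Icc (a := -Real.pi) (b := Real.pi)).mono_set
      (Set.inter_subset_right.trans Set.Ioc_subset_Icc_self)
  have hDint (φ : ℝ) : ∫ θ in (-φ)..φ, D θ = 1 / M * (2 * sineKernel 0 φ + 2 * sineKernel d φ) := by
    rw [← integral_two_add_two_mul_cos]
    simp only [hD, intervalIntegral.integral_const_mul]
  set f : ℝ → ℝ := fun θ => 2 * Real.cos θ - u with hf
  have hfm : Measurable f := by simp only [hf]; fun_prop
  have : IsProbabilityMeasure ρ := ⟨by
    rw [hρA MeasurableSet.univ, Set.univ_inter, ← intervalIntegral.integral_of_le (by linarith),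
      hDint, ← hM, one_div_mul_cancel hM0.ne', ENNReal.ofReal_one]⟩
  have : IsProbabilityMeasure (ρ.map f) := Measure.isProbabilityMeasure_map hfm.aemeasurable
  have h0 : (ρ.map f) {0} = 0 := by
    rw [Measure.map_apply hfm (measurableSet_singleton 0)]
    exact ((withDensity_absolutelyContinuous _ _).trans Measure.absolutelyContinuous_restrict)
      (volume_preimage_zero_two_mul_cos_sub hu)
  have hmass : (ρ.map f).real (Set.Ici 0) = 1 / M *
      (2 * sineKernel 0 (Real.arccos (u / 2)) + 2 * sineKernel d (Real.arccos (u / 2))) := by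
    have hφ0 := Real.arccos_nonneg (u / 2)
    rw [Measure.real, Measure.map_apply hfm measurableSet_Ici, hρA (hfm measurableSet_Ici), hf,
      preimage_Ici_zero_two_mul_cos_sub hu, integral_Icc_eq_integral_Ioc,
      ENNReal.toReal_ofReal (integral_nonneg hD0),
      ← intervalIntegral.integral_of_le (by linarith), hDint]
  have hchar (s : ℝ) : charFun (ρ.map f) s = ((1 / M : ℝ) : ℂ) * ((1 / (2 * (Real.pi : ℂ))) *
      ∫ θ in (-Real.pi)..Real.pi, Complex.exp ((s * (2 * Real.cos θ - u) : ℝ) * Complex.I) *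
          ((2 + 2 * Real.cos (d * θ) : ℝ) : ℂ)) := by
    rw [charFun_apply_real, integral_map hfm.aemeasurable (by fun_prop), hρ,
      integral_withDensity_eq_integral_toReal_smul (by fun_prop)
        (Eventually.of_forall fun _ => ENNReal.ofReal_lt_top),
      ← intervalIntegral.integral_of_le (by linarith), ← intervalIntegral.integral_const_mul,
      ← intervalIntegral.integral_const_mul]
    refine intervalIntegral.integral_congr fun θ _ => ?_
    rw [ENNReal.toReal_ofReal (hD0 θ), Complex.real_smul]
    simp only [hD, hf]
    push_cast
    ring
  have key := tendsto_tsum_nat_of_tendsto_charFun (ν := ρ.map f) (t := t)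
    (a := fun k j => 1 / M * (besselJ (t k) (n k + d + j) + besselJ (t k) (n k + j)) ^ 2)
    (fun k j => by positivity) (fun k => ?_) (ht.eventually_gt_atTop 0) h0 (fun s => ?_)
  · rw [hmass] at key
    have h2 := key.const_mul M
    simpa only [tsum_mul_left, ← mul_assoc, mul_one_div_cancel hM0.ne', one_mul] using h2
  · have h2 := (hasSum_besselJ_sq (t k) (n k) d).mul_left (1 / M)
    rwa [integral_two_add_two_mul_cos, ← hM, one_div_mul_cancel hM0.ne'] at h2
  · rw [hchar]
    have h2 := (tendsto_tsum_besselJ_sq_mul_exp ht hn d s).const_mul ((1 / M : ℝ) : ℂ)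
    refine h2.congr fun k => ?_
    rw [← tsum_mul_left]
    refine tsum_congr fun j => ?_
    push_cast
    ring

theorem tendsto_tsum_besselJ_mul_besselJ {t : ℕ → ℝ} {n : ℕ → ℤ} {u : ℝ}
    (hu : u ∈ Set.Ioo (-2 : ℝ) 2) (ht : Tendsto t atTop atTop)
    (hn : Tendsto (fun k => n k / t k) atTop (𝓝 u)) (d : ℤ) :
    Tendsto (fun k => ∑' j : ℕ, besselJ (t k) (n k + d + j) * besselJ (t k) (n k + j)) atTop
      (𝓝 (sineKernel d (Real.arccos (u / 2)))) := by
  have hsummable (k : ℕ) (m e : ℤ) :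
      Summable fun j : ℕ => (besselJ (t k) (m + e + j) + besselJ (t k) (m + j)) ^ 2 :=
    (hasSum_besselJ_sq (t k) m e).summable.comp_injective (i := ((↑) : ℕ → ℤ)) Nat.cast_injective
  have hnd : Tendsto (fun k => ((n k + d : ℤ) : ℝ) / t k) atTop (𝓝 u) := by
    have := hn.add ((tendsto_const_nhds (x := (d : ℝ))).div_atTop ht)
    rw [add_zero] at this
    refine this.congr fun k => ?_
    push_cast; ring
  have h1 := tendsto_tsum_besselJ_sq hu ht hn d
  have h2 := tendsto_tsum_besselJ_sq hu ht hn 0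
  have h3 := tendsto_tsum_besselJ_sq hu ht hnd 0
  -- Polarization: ab = (a + b)²/2 - ((2a)² + (2b)²)/8. The case d = 0 supplies the squares of 2b
  -- and, with n shifted by d, of 2a.
  have h4 := (h1.const_mul (1 / 2)).sub ((h2.add h3).const_mul (1 / 8))
  convert h4 using 2 with k
  · rw [← tsum_mul_left, ← (hsummable k (n k) 0).tsum_add (hsummable k (n k + d) 0),
      ← tsum_mul_left, ← ((hsummable k (n k) d).mul_left _).tsum_sub
        (((hsummable k (n k) 0).add (hsummable k (n k + d) 0)).mul_left _)]
    refine tsum_congr fun j => ?_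
    simp only [add_zero]
    ring
  · ring

/-! ### Contour integrals: the kernel as a series of Bessel products -/

theorem hasSum_circleIntegral {f : ℕ → ℂ → ℂ} {F : ℂ → ℂ} {c : ℂ} {R : ℝ} {b : ℕ → ℝ} (hR : 0 ≤ R)
    (hf : ∀ j, ContinuousOn (f j) (Metric.sphere c R))
    (hb : ∀ j, ∀ z ∈ Metric.sphere c R, ‖f j z‖ ≤ b j) (hs : Summable b)
    (hF : ∀ z ∈ Metric.sphere c R, HasSum (fun j => f j z) (F z)) :
    HasSum (fun j => ∮ z in C(c, R), f j z) (∮ z in C(c, R), F z) := by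
  have hm (θ : ℝ) : circleMap c R θ ∈ Metric.sphere c R := circleMap_mem_sphere c hR θ
  refine intervalIntegral.hasSum_integral_of_dominated_convergence (fun j _ => R * b j)
    (fun j => ?_) (fun j => ?_) ?_ ?_ ?_
  · refine Continuous.aestronglyMeasurable ?_
    have := (hf j).comp_continuous (continuous_circleMap c R) hm
    simp only [deriv_circleMap, smul_eq_mul]
    exact ((continuous_circleMap 0 R).mul continuous_const).mul this
  · refine Eventually.of_forall fun θ _ => ?_
    rw [norm_smul]
    have : ‖deriv (circleMap c R) θ‖ = R := by simp [abs_of_nonneg hR]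
    rw [this]
    exact mul_le_mul_of_nonneg_left (hb j _ (hm θ)) hR
  · exact Eventually.of_forall fun _ _ => hs.mul_left _
  · exact intervalIntegrable_const
  · exact Eventually.of_forall fun θ _ => (hF _ (hm θ)).const_smul _

theorem hasSum_pow_div_pow_succ {z w : ℂ} (h : ‖w‖ < ‖z‖) :
    HasSum (fun j : ℕ => w ^ j * (z ^ (j + 1))⁻¹) (z - w)⁻¹ := by
  have hz : z ≠ 0 := fun h0 => by simp [h0] at h; linarith [norm_nonneg w]
  have hzw : z - w ≠ 0 := fun h0 => by rw [sub_eq_zero.mp h0] at h; exact lt_irrefl _ h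
  have hq : ‖w / z‖ < 1 := by rw [norm_div]; exact (div_lt_one (norm_pos_iff.mpr hz)).mpr h
  have key := (hasSum_geometric_of_norm_lt_one hq).mul_left z⁻¹
  have e : z⁻¹ * (1 - w / z)⁻¹ = (z - w)⁻¹ := by
    rw [← mul_inv, mul_sub, mul_div_cancel₀ _ hz, mul_one]
  rw [e] at key
  refine (congrArg (HasSum · _) (funext fun j => ?_)).mp key
  rw [div_pow, pow_succ, mul_inv]; ring

/-- The geometric expansion of a double contour integral with Cauchy kernel `1 / (z - w)`. -/
theorem hasSum_circleIntegral_circleIntegral {f g : ℂ → ℂ} {r R : ℝ} (hr : 0 < r) (hrR : r < R)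
    (hf : ContinuousOn f (Metric.sphere 0 R)) (hg : ContinuousOn g (Metric.sphere 0 r)) :
    HasSum (fun j : ℕ => (∮ z in C(0, R), f z * (z ^ (j + 1))⁻¹) * ∮ w in C(0, r), g w * w ^ j)
      (∮ z in C(0, R), ∮ w in C(0, r), f z * g w * (z - w)⁻¹) := by
  have hR : 0 < R := hr.trans hrR
  obtain ⟨C, hC⟩ := (isCompact_sphere (0 : ℂ) r).exists_bound_of_continuousOn hg
  obtain ⟨D, hD⟩ := (isCompact_sphere (0 : ℂ) R).exists_bound_of_continuousOn hf
  have hC0 : 0 ≤ C := (norm_nonneg _).trans (hC r (by simp [abs_of_pos hr]))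
  have hD0 : 0 ≤ D := (norm_nonneg _).trans (hD R (by simp [abs_of_pos hR]))
  have hq : Summable fun j : ℕ => (r / R) ^ j :=
    summable_geometric_of_lt_one (by positivity) ((div_lt_one hR).mpr hrR)
  have hz0 (z : ℂ) (hz : z ∈ Metric.sphere (0 : ℂ) R) : z ≠ 0 := by
    rintro rfl; simp at hz; exact hR.ne' hz.symm
  have hgw (j : ℕ) (w : ℂ) (hw : w ∈ Metric.sphere (0 : ℂ) r) : ‖g w * w ^ j‖ ≤ C * r ^ j := by
    rw [norm_mul, norm_pow, mem_sphere_zero_iff_norm.mp hw]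
    exact mul_le_mul_of_nonneg_right (hC w hw) (by positivity)
  have hB (j : ℕ) : ‖∮ w in C(0, r), g w * w ^ j‖ ≤ 2 * Real.pi * r * (C * r ^ j) :=
    circleIntegral.norm_integral_le_of_norm_le_const hr.le (hgw j)
  have inner (z : ℂ) (hz : z ∈ Metric.sphere (0 : ℂ) R) :
      HasSum (fun j : ℕ => (f z * (z ^ (j + 1))⁻¹) * ∮ w in C(0, r), g w * w ^ j)
        (∮ w in C(0, r), f z * g w * (z - w)⁻¹) := by
    have hzR := mem_sphere_zero_iff_norm.mp hz
    have key := hasSum_circleIntegral (c := 0) (R := r)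
      (f := fun j w => (f z * (z ^ (j + 1))⁻¹) * (g w * w ^ j))
      (F := fun w => f z * g w * (z - w)⁻¹) (b := fun j => D * R⁻¹ * C * (r / R) ^ j) hr.le
      (fun j => continuousOn_const.mul (hg.mul (continuousOn_id.pow j))) ?_ (hq.mul_left _) ?_
    · simpa only [circleIntegral.integral_const_mul] using key
    · intro j w hw
      calc _ = ‖f z‖ * (R ^ (j + 1))⁻¹ * ‖g w * w ^ j‖ := by
            rw [norm_mul, norm_mul, norm_inv, norm_pow, hzR]
        _ ≤ D * (R ^ (j + 1))⁻¹ * (C * r ^ j) := by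
            gcongr
            · exact hD z hz
            · exact hgw j w hw
        _ = _ := by rw [div_pow, pow_succ, mul_inv]; ring
    · intro w hw
      have h := (hasSum_pow_div_pow_succ (z := z) (w := w) (by
        rw [hzR, mem_sphere_zero_iff_norm.mp hw]; exact hrR)).mul_left (f z * g w)
      refine (congrArg (HasSum · _) (funext fun j => ?_)).mp h
      ring
  have key := hasSum_circleIntegral (c := 0) (R := R)
    (f := fun j z => (f z * (z ^ (j + 1))⁻¹) * ∮ w in C(0, r), g w * w ^ j)
    (b := fun j => D * R⁻¹ * (2 * Real.pi * r) * C * (r / R) ^ j) hR.le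
    (fun j => (hf.mul ((continuousOn_id.pow _).inv₀ fun z hz => pow_ne_zero _ (hz0 z hz))).mul
      continuousOn_const) ?_ (hq.mul_left _) inner
  · refine (congrArg (HasSum · _) (funext fun j => ?_)).mp key
    simp only [mul_comm _ (∮ w in C(0, r), g w * w ^ j), circleIntegral.integral_const_mul]
  · intro j z hz
    calc _ = ‖f z‖ * (R ^ (j + 1))⁻¹ * ‖∮ w in C(0, r), g w * w ^ j‖ := by
          rw [norm_mul, norm_mul, norm_inv, norm_pow, mem_sphere_zero_iff_norm.mp hz]
      _ ≤ D * (R ^ (j + 1))⁻¹ * (2 * Real.pi * r * (C * r ^ j)) := by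
          gcongr
          · exact hD z hz
          · exact hB j
      _ = _ := by rw [div_pow, pow_succ, mul_inv]; ring

theorem circleIntegral_eq_of_differentiableAt_ne_zero {f : ℂ → ℂ}
    (hf : ∀ z, z ≠ 0 → DifferentiableAt ℂ f z) {r R : ℝ} (hr : 0 < r) (hR : 0 < R) :
    (∮ z in C(0, R), f z) = ∮ z in C(0, r), f z := by
  have aux {r R : ℝ} (hr : 0 < r) (h : r ≤ R) : (∮ z in C(0, R), f z) = ∮ z in C(0, r), f z := by
    refine Complex.circleIntegral_eq_of_differentiable_on_annulus_off_countable hr h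
      Set.countable_empty (fun z hz => ?_) (fun z hz => ?_)
    · refine (hf z ?_).continuousAt.continuousWithinAt
      rintro rfl
      exact hz.2 (by simpa using hr)
    · refine hf z ?_
      rintro rfl
      exact hz.1.2 (by simpa using hr.le)
  rcases le_total r R with h | h
  · exact aux hr h
  · exact (aux hR h).symm

theorem differentiableAt_exp_mul_zpow (a : ℂ) (n : ℤ) {z : ℂ} (hz : z ≠ 0) :
    DifferentiableAt ℂ (fun z => Complex.exp (a * (z - z⁻¹)) * z ^ n) z := by
  have h1 : DifferentiableAt ℂ (fun z : ℂ => z ^ n) z := differentiableAt_zpow.mpr (Or.inl hz)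
  have h2 : DifferentiableAt ℂ (fun z : ℂ => z⁻¹) z := differentiableAt_inv hz
  fun_prop

theorem circleMap_zero_one_sub_inv (θ : ℝ) :
    circleMap 0 1 θ - (circleMap 0 1 θ)⁻¹ = (2 * Real.sin θ : ℝ) * Complex.I := by
  rw [circleMap_zero]
  simp only [Complex.ofReal_one, one_mul, ← Complex.exp_neg]
  push_cast
  have := Complex.two_sin (θ : ℂ)
  rw [this]
  rw [neg_mul]
  linear_combination (Complex.exp (θ * Complex.I) - Complex.exp (-(θ * Complex.I))) * Complex.I_sq

theorem circleMap_zero_one_zpow (θ : ℝ) (n : ℤ) :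
    circleMap 0 1 θ ^ n = Complex.exp (n * θ * Complex.I) := by
  rw [circleMap_zero]
  simp only [Complex.ofReal_one, one_mul]
  rw [← Complex.exp_int_mul, mul_assoc]

theorem deriv_circleMap_mul_zpow_sub_one (θ : ℝ) (n : ℤ) :
    deriv (circleMap 0 1) θ * circleMap 0 1 θ ^ (n - 1) =
      Complex.I * Complex.exp (n * θ * Complex.I) := by
  have h0 : circleMap 0 1 θ ≠ 0 := circleMap_ne_center one_ne_zero
  rw [deriv_circleMap, ← circleMap_zero_one_zpow, zpow_sub_one₀ h0]
  field_simp

/-- Schläfli's contour integral for the Bessel function `Jₙ(2t)`. -/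
theorem circleIntegral_exp_mul_zpow_neg (t : ℝ) (n : ℤ) {r : ℝ} (hr : 0 < r) :
    (∮ z in C(0, r), Complex.exp (t * (z - z⁻¹)) * z ^ (-n - 1)) =
      2 * Real.pi * Complex.I * besselJ t n := by
  rw [circleIntegral_eq_of_differentiableAt_ne_zero
    (fun z hz => differentiableAt_exp_mul_zpow t (-n - 1) hz) one_pos hr, circleIntegral]
  have h1 (θ : ℝ) : deriv (circleMap 0 1) θ • (Complex.exp (t * (circleMap 0 1 θ -
      (circleMap 0 1 θ)⁻¹)) * circleMap 0 1 θ ^ (-n - 1)) =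
      Complex.I * (Complex.exp (-(n * θ * Complex.I)) * besselGen t θ) := by
    rw [smul_eq_mul, mul_left_comm, deriv_circleMap_mul_zpow_sub_one, circleMap_zero_one_sub_inv,
      besselGen]
    push_cast
    rw [mul_left_comm, mul_comm (Complex.exp _)]
    congr 3 <;> ring
  simp_rw [h1]
  have hper : Function.Periodic (fun θ : ℝ => Complex.exp (-(n * θ * Complex.I)) * besselGen t θ)
      (2 * Real.pi) := (exp_int_mul_periodic n).mul (besselGen_periodic t)
  have h2 := hper.intervalIntegral_add_eq 0 (-Real.pi)
  rw [zero_add, show -Real.pi + 2 * Real.pi = Real.pi by ring] at h2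
  have hpi : (Real.pi : ℂ) ≠ 0 := by exact_mod_cast Real.pi_ne_zero
  rw [intervalIntegral.integral_const_mul, h2, ofReal_besselJ, periodicCoeff]
  field_simp

/-- On the unit circle conjugation is z ↦ z⁻¹, so this is the conjugate of Schläfli's integral; the
sign from conjugating i in dz cancels that of the right-hand side, as J is real. -/
theorem circleIntegral_exp_neg_mul_zpow (t : ℝ) (n : ℤ) {r : ℝ} (hr : 0 < r) :
    (∮ w in C(0, r), Complex.exp (-t * (w - w⁻¹)) * w ^ (n - 1)) =
      2 * Real.pi * Complex.I * besselJ t n := by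
  have h1 := circleIntegral_exp_mul_zpow_neg t n one_pos
  rw [circleIntegral_eq_of_differentiableAt_ne_zero
    (fun z hz => differentiableAt_exp_mul_zpow (-t) (n - 1) hz) one_pos hr]
  have h2 := congrArg conj h1
  rw [circleIntegral, ← intervalIntegral.intervalIntegral_conj] at h2
  have h3 : conj (2 * Real.pi * Complex.I * besselJ t n : ℂ) =
      -(2 * Real.pi * Complex.I * besselJ t n) := by
    simp [Complex.conj_ofNat]
  rw [h3] at h2
  rw [circleIntegral, ← neg_eq_iff_eq_neg.mpr h2, ← intervalIntegral.integral_neg]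
  refine intervalIntegral.integral_congr fun θ _ => ?_
  simp only [smul_eq_mul]
  rw [mul_left_comm, deriv_circleMap_mul_zpow_sub_one, mul_left_comm (deriv _ _),
    deriv_circleMap_mul_zpow_sub_one, circleMap_zero_one_sub_inv]
  simp only [map_mul, ← Complex.exp_conj, Complex.conj_ofReal, Complex.conj_I]
  simp

/-- The discrete Bessel kernel is the sum of products of Bessel functions. -/
theorem hasSum_besselJ_mul_besselJ {R r : ℝ} (hr : 0 < r) (hrR : r < R) (ξ : ℝ) (m n : ℤ) :
    HasSum (fun j : ℕ => ((besselJ (Real.sqrt ξ) (m + 1 + j) * besselJ (Real.sqrt ξ) (n + 1 + j) :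
      ℝ) : ℂ)) (besselKernel R r (m + 1 / 2) (n + 1 / 2) ξ) := by
  have hR : 0 < R := hr.trans hrR
  set t := Real.sqrt ξ with ht
  have h0 {ρ : ℝ} (hρ : 0 < ρ) {z : ℂ} (hz : z ∈ Metric.sphere (0 : ℂ) ρ) : z ≠ 0 := by
    rintro rfl; simp at hz; exact hρ.ne' hz.symm
  have hcont (a : ℂ) (k : ℤ) {ρ : ℝ} (hρ : 0 < ρ) :
      ContinuousOn (fun z => Complex.exp (a * (z - z⁻¹)) * z ^ k) (Metric.sphere 0 ρ) :=
    fun z hz => (differentiableAt_exp_mul_zpow a k (h0 hρ hz)).continuousAt.continuousWithinAt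
  -- Here x + 1/2 = m + 1 and -y + 1/2 = -n; the factors z^{-(j+1)} and w^j then raise the Bessel
  -- orders to m + 1 + j and n + 1 + j.
  have key := (hasSum_circleIntegral_circleIntegral hr hrR (hcont t (-(m + 1)) hR)
    (hcont (-t) n hr)).mul_left (1 / (2 * (Real.pi : ℂ) * Complex.I) ^ 2)
  have hpi : (Real.pi : ℂ) ≠ 0 := by exact_mod_cast Real.pi_ne_zero
  have hK : besselKernel R r (m + 1 / 2) (n + 1 / 2) ξ =
      1 / (2 * (Real.pi : ℂ) * Complex.I) ^ 2 * ∮ z in C(0, R), ∮ w in C(0, r),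
        (Complex.exp (t * (z - z⁻¹)) * z ^ (-(m + 1))) *
          (Complex.exp (-t * (w - w⁻¹)) * w ^ n) * (z - w)⁻¹ := by
    rw [besselKernel]
    congr 1
    refine circleIntegral.integral_congr hR.le fun z hz => ?_
    refine circleIntegral.integral_congr hr.le fun w hw => ?_
    have e1 : (((m : ℝ) + 1 / 2 : ℝ) : ℂ) + 1 / 2 = ((m + 1 : ℤ) : ℂ) := by push_cast; ring
    have e2 : -(((n : ℝ) + 1 / 2 : ℝ) : ℂ) + 1 / 2 = ((-n : ℤ) : ℂ) := by push_cast; ring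
    have e3 : Complex.exp ((t : ℂ) * (z - z⁻¹ - w + w⁻¹)) =
        Complex.exp (t * (z - z⁻¹)) * Complex.exp (-t * (w - w⁻¹)) := by
      rw [← Complex.exp_add]; congr 1; ring
    rw [e1, e2, Complex.cpow_intCast, Complex.cpow_intCast, e3, zpow_neg, zpow_neg, one_div,
      mul_inv, inv_inv]
    ring
  rw [hK]
  refine (congrArg (HasSum · _) (funext fun j => ?_)).mp key
  have i1 : (∮ z in C(0, R), Complex.exp (t * (z - z⁻¹)) * z ^ (-(m + 1)) * (z ^ (j + 1))⁻¹) =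
      2 * Real.pi * Complex.I * besselJ t (m + 1 + j) := by
    rw [← circleIntegral_exp_mul_zpow_neg t _ hR]
    refine circleIntegral.integral_congr hR.le fun z hz => ?_
    rw [mul_assoc, ← zpow_natCast, ← zpow_neg, ← zpow_add₀ (h0 hR hz)]
    congr 2
    push_cast; ring
  have i2 : (∮ w in C(0, r), Complex.exp (-t * (w - w⁻¹)) * w ^ n * w ^ j) =
      2 * Real.pi * Complex.I * besselJ t (n + 1 + j) := by
    rw [← circleIntegral_exp_neg_mul_zpow t _ hr]
    refine circleIntegral.integral_congr hr.le fun w hw => ?_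
    rw [mul_assoc, ← zpow_natCast, ← zpow_add₀ (h0 hr hw)]
    congr 2
    ring
  rw [i1, i2]
  have hI := Complex.I_ne_zero
  push_cast
  field_simp

/-! ### From sequences to arbitrary filters, and the conclusion -/

/-- The limit depends on the index only through (t, n). On such pairs the filter "t → ∞, n/t → u" is
countably generated, so sequences suffice even if `l` is not countably generated. -/
theorem tendsto_of_seq_tendsto_ratio {S : ℝ → ℤ → ℝ} {u L : ℝ}
    (hS : ∀ (t : ℕ → ℝ) (n : ℕ → ℤ), Tendsto t atTop atTop →
      Tendsto (fun k => n k / t k) atTop (𝓝 u) → Tendsto (fun k => S (t k) (n k)) atTop (𝓝 L))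
    {ι : Type*} {l : Filter ι} {t : ι → ℝ} {n : ι → ℤ} (ht : Tendsto t l atTop)
    (hn : Tendsto (fun i => n i / t i) l (𝓝 u)) : Tendsto (fun i => S (t i) (n i)) l (𝓝 L) := by
  have key : Tendsto (fun p : ℝ × ℤ => S p.1 p.2)
      (comap (fun p : ℝ × ℤ => (p.1, p.2 / p.1)) (atTop ×ˢ 𝓝 u)) (𝓝 L) := by
    refine tendsto_of_seq_tendsto fun p hp => ?_
    obtain ⟨h1, h2⟩ := tendsto_prod_iff'.mp (tendsto_comap_iff.mp hp)
    exact hS _ _ h1 h2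
  have hg : Tendsto (fun i => (t i, n i)) l
      (comap (fun p : ℝ × ℤ => (p.1, p.2 / p.1)) (atTop ×ˢ 𝓝 u)) :=
    tendsto_comap_iff.mpr (ht.prodMk hn)
  exact key.comp hg

theorem mainTheorem2 {ι : Type*} (l : Filter ι) (u : ℝ) (hu : u ∈ Set.Ioo (-2 : ℝ) 2) (d : ℤ)
    (ξ x y R r : ι → ℝ)
    (hξ : Tendsto ξ l atTop)
    (hx_half : ∀ i, x i ∈ halfIntegers) (hy_half : ∀ i, y i ∈ halfIntegers)
    (hx : Tendsto (fun i => x i / Real.sqrt (ξ i)) l (𝓝 u))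
    (hy : Tendsto (fun i => y i / Real.sqrt (ξ i)) l (𝓝 u))
    (hxy : ∀ i, x i - y i = (d : ℝ))
    (hr : ∀ i, 0 < r i) (hR : ∀ i, r i < R i) :
    Tendsto (fun i => besselKernel (R i) (r i) (x i) (y i) (ξ i)) l
      (𝓝 ((sineKernel d (Real.arccos (u / 2)) : ℝ) : ℂ)) := by
  choose k hk using hy_half
  have ht : Tendsto (fun i => Real.sqrt (ξ i)) l atTop := Real.tendsto_sqrt_atTop.comp hξ
  -- With y = k + 1/2 the Bessel series starts at order k + 1, so k + 1 plays the role of n.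
  have hn : Tendsto (fun i => ((k i + 1 : ℤ) : ℝ) / Real.sqrt (ξ i)) l (𝓝 u) := by
    have h := hy.add ((tendsto_const_nhds (x := (1 / 2 : ℝ))).div_atTop ht)
    rw [add_zero] at h
    refine h.congr fun i => ?_
    rw [hk]; push_cast; ring
  have key := (Complex.continuous_ofReal.tendsto _).comp
    (tendsto_of_seq_tendsto_ratio
      (S := fun t n => ∑' j : ℕ, besselJ t (n + d + j) * besselJ t (n + j))
      (fun _ _ ht hn => tendsto_tsum_besselJ_mul_besselJ hu ht hn d) ht hn)
  refine key.congr fun i => ?_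
  have h := (hasSum_besselJ_mul_besselJ (hr i) (hR i) (ξ i) (k i + d) (k i)).tsum_eq
  have hxi : x i = ((k i + d : ℤ) : ℝ) + 1 / 2 := by
    have := hxy i
    rw [hk i] at this
    push_cast; linarith
  rw [hxi, hk i, ← h, Function.comp_apply, Complex.ofReal_tsum]
  simp only [add_right_comm (k i) d 1]
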